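/- Let $\mathcal H$ be a separable complex Hilbert space, let $P\colon \mathcal D(P)\to\mathcal H$ be a densely defined (possibly unbounded) self-adjoint operator on $\mathcal H$, and let $Q$ be a bounded self-adjoint operator on $\mathcal H$. For a self-adjoint operator $A$ let $(\mathrm e^{itA})_{t\in\mathbb R}$ denote the strongly continuous one-parameter unitary group generated by $A$, that is, the one for which $x\in\mathcal D(A)$ if and only if $t\mapsto \mathrm e^{itA}x$ is differentiable at $0$, with derivative $iAx$ in this case. Assume that $$[\mathrm e^{itP}Q\,\mathrm e^{-itP},\ \mathrm e^{isP}Q\,\mathrm e^{-isP}]=0\qquad\text{for all } s,t\in[0,1].$$ Then the operator $P+Q$ with domain $\mathcal D(P)$ is self-adjoint, the unitary groups $\mathrm e^{itP}$ and $\mathrm e^{it(P+Q)}$ exist, the integral $\int_0^1 \mathrm e^{itP}Q\,\mathrm e^{-itP}\,dt$ exists as a bounded operator in the strong sense (it maps $x\in\mathcal H$ to $\int_0^1 \mathrm e^{itP}Q\,\mathrm e^{-itP}x\,dt$, the integrand being integrable), and $$\exp\Bigl(i\int_0^1 \mathrm e^{itP}Q\,\mathrm e^{-itP}\,dt\Bigr)\,\mathrm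 e^{iP}=\mathrm e^{i(P+Q)}.$$ -/

import Mathlib

open scoped InnerProductSpace

/-- `U` is the strongly continuous one-parameter unitary group `t ↦ e^{itA}` generated by the
(unbounded) operator `A`: the domain of `A` consists of exactly those `x` for which `t ↦ U t x` is
differentiable at `0`, and there the derivative is `i A x`. -/
structure IsUnitaryGroupOf {H : Type*} [NormedAddCommGroup H] [InnerProductSpace ℂ H]
    [CompleteSpace H] (A : H →ₗ.[ℂ] H) (U : ℝ → H →L[ℂ] H) : Prop where
  unitary_apply : ∀ t, U t ∈ unitary (H →L[ℂ] H)
  map_zero : U 0 = 1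
  map_add : ∀ s t, U (s + t) = U s * U t
  continuous_apply : ∀ x, Continuous fun t => U t x
  mem_graph_iff : ∀ x y, (x, y) ∈ A.graph ↔ HasDerivAt (fun t => U t x) (Complex.I • y) 0

namespace IsUnitaryGroupOf

variable {H : Type*} [NormedAddCommGroup H] [InnerProductSpace ℂ H] [CompleteSpace H]
  {A : H →ₗ.[ℂ] H} {U V : ℝ → H →L[ℂ] H}

lemma hasDerivAt (hU : IsUnitaryGroupOf A U) {x y : H} (hxy : (x, y) ∈ A.graph) (s : ℝ) :
    HasDerivAt (fun t => U t x) (Complex.I • U s y) s := by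
  have h0 := (hU.mem_graph_iff x y).1 hxy
  have h1 : HasDerivAt (fun t => U (t - s) x) (Complex.I • y) s :=
    HasDerivAt.comp_sub_const s s (by simpa using h0)
  have h2 := ((U s).restrictScalars ℝ).hasFDerivAt.comp_hasDerivAt s h1
  have h3 : (fun t => U t x) = ((U s).restrictScalars ℝ) ∘ fun t => U (t - s) x := by
    funext t
    have := hU.map_add s (t - s)
    rw [add_sub_cancel] at this
    simp [this]
  rw [h3]
  simpa using h2

lemma apply_mem_graph (hU : IsUnitaryGroupOf A U) {x y : H} (hxy : (x, y) ∈ A.graph) (s : ℝ) :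
    (U s x, U s y) ∈ A.graph := by
  rw [hU.mem_graph_iff]
  have h1 : HasDerivAt (fun t => U (t + s) x) (Complex.I • U s y) 0 :=
    HasDerivAt.comp_add_const 0 s (by simpa using hU.hasDerivAt hxy s)
  simpa [hU.map_add] using h1

/-- The unitary group generated by a self-adjoint operator is unique. -/
theorem unique (hA : IsSelfAdjoint A) (hU : IsUnitaryGroupOf A U) (hV : IsUnitaryGroupOf A V) :
    U = V := by
  have hsymm : ∀ {x y : H}, (x, y) ∈ A.graph → ⟪y, x⟫_ℂ = ⟪x, y⟫_ℂ := by
    intro x y hxy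
    obtain ⟨z, rfl, rfl⟩ := (LinearPMap.mem_graph_iff A).1 hxy
    have h := LinearPMap.adjoint_isFormalAdjoint hA.dense_domain
    rw [LinearPMap.isSelfAdjoint_def.1 hA] at h
    exact h z z
  let _ : InnerProductSpace ℝ H := InnerProductSpace.rclikeToReal ℂ H
  funext t
  refine ContinuousLinearMap.ext fun x => ?_
  refine congrFun (Continuous.ext_on hA.dense_domain (U t).continuous (V t).continuous ?_) x
  intro x hx
  have hxy : (x, A ⟨x, hx⟩) ∈ A.graph := LinearPMap.mem_graph A ⟨x, hx⟩
  set y := A ⟨x, hx⟩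
  have hd : ∀ s, HasDerivAt (fun s => ‖U s x - V s x‖ ^ 2) 0 s := by
    intro s
    have h0 := (hU.hasDerivAt hxy s).sub (hV.hasDerivAt hxy s)
    have h1 := HasDerivAt.norm_sq (F := H) h0
    have hg : (U s x - V s x, U s y - V s y) ∈ A.graph :=
      A.graph.sub_mem (hU.apply_mem_graph hxy s) (hV.apply_mem_graph hxy s)
    have h2 := hsymm hg
    refine HasDerivAt.congr_deriv (f := fun s => ‖U s x - V s x‖ ^ 2) h1 ?_
    rw [← smul_sub]
    set w := U s x - V s x
    set v := U s y - V s y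
    have h3 : (⟪w, v⟫_ℂ).im = 0 := by
      have := congrArg Complex.im h2
      rw [← inner_conj_symm, Complex.conj_im] at this
      linarith
    have h4 : inner ℝ w (Complex.I • v) = (⟪w, Complex.I • v⟫_ℂ).re := rfl
    change 2 * inner ℝ w (Complex.I • v) = 0
    rw [h4, inner_smul_right]
    simp [h3]
  have hc := is_const_of_deriv_eq_zero (fun s => (hd s).differentiableAt)
    (fun s => (hd s).deriv) t 0
  have hz : ‖U t x - V t x‖ ^ 2 = 0 := by
    rw [hc]; simp [hU.map_zero, hV.map_zero]
  exact sub_eq_zero.1 (norm_eq_zero.1 (pow_eq_zero_iff two_ne_zero |>.1 hz))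

end IsUnitaryGroupOf

open scoped Classical in
/-- `expI A t` is the operator `e^{itA}`: the value at time `t` of the strongly continuous unitary
group generated by `A` (and `0` if `A` does not generate such a group, that is, if `A` is not
self-adjoint). -/
noncomputable def expI {H : Type*} [NormedAddCommGroup H] [InnerProductSpace ℂ H]
    [CompleteSpace H] (A : H →ₗ.[ℂ] H) : ℝ → H →L[ℂ] H :=
  if h : ∃ U, IsUnitaryGroupOf A U then h.choose else 0

theorem IsUnitaryGroupOf.expI_eq {H : Type*} [NormedAddCommGroup H] [InnerProductSpace ℂ H]
    [CompleteSpace H] {A : H →ₗ.[ℂ] H} {U : ℝ → H →L[ℂ] H} (hU : IsUnitaryGroupOf A U)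
    (hA : IsSelfAdjoint A) : expI A = U := by
  have h : ∃ U, IsUnitaryGroupOf A U := ⟨U, hU⟩
  rw [expI, dif_pos h]
  exact h.choose_spec.unique hA hU

/-- `T` is the strong integral `∫ t in a..b, F t` of the family `F` of bounded operators: for every
vector `x` the function `t ↦ F t x` is integrable and `T x = ∫ t in a..b, F t x`. (The integral is
not taken in the operator norm, in which `t ↦ e^{itP} Q e^{-itP}` need not be measurable.) -/
def HasStrongIntegral {H : Type*} [NormedAddCommGroup H] [InnerProductSpace ℂ H]
    (F : ℝ → H →L[ℂ] H) (a b : ℝ) (T : H →L[ℂ] H) : Prop :=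
  ∀ x, IntervalIntegrable (fun t => F t x) MeasureTheory.volume a b ∧ T x = ∫ t in a..b, F t x

open scoped Classical in
/-- The strong integral of a family of bounded operators (`0` if there is none). -/
noncomputable def strongIntegral {H : Type*} [NormedAddCommGroup H] [InnerProductSpace ℂ H]
    (F : ℝ → H →L[ℂ] H) (a b : ℝ) : H →L[ℂ] H :=
  if h : ∃ T, HasStrongIntegral F a b T then h.choose else 0

theorem HasStrongIntegral.strongIntegral_eq {H : Type*} [NormedAddCommGroup H]
    [InnerProductSpace ℂ H] {F : ℝ → H →L[ℂ] H} {a b : ℝ} {T : H →L[ℂ] H}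
    (hT : HasStrongIntegral F a b T) : strongIntegral F a b = T := by
  have h : ∃ T, HasStrongIntegral F a b T := ⟨T, hT⟩
  rw [strongIntegral, dif_pos h]
  exact ContinuousLinearMap.ext fun x => ((h.choose_spec x).2).trans (hT x).2.symm

/-- The conjugate `e^{itP} Q e^{-itP}`. -/
noncomputable def conjExpI {H : Type*} [NormedAddCommGroup H] [InnerProductSpace ℂ H]
    [CompleteSpace H] (P : H →ₗ.[ℂ] H) (Q : H →L[ℂ] H) (t : ℝ) : H →L[ℂ] H :=
  expI P t * Q * expI P (-t)

/-- The sum `P + Q`, with domain that of `P`, of an unbounded and a bounded operator. -/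
noncomputable def addBounded {H : Type*} [NormedAddCommGroup H] [InnerProductSpace ℂ H]
    (P : H →ₗ.[ℂ] H) (Q : H →L[ℂ] H) : H →ₗ.[ℂ] H :=
  P + (Q : H →ₗ[ℂ] H).toPMap ⊤

/-! Write `U t` for e^{itP}, `V t` for e^{it(P+Q)} and `K t` for `U t * Q * U (-t)`. In the
interaction picture the product `V t * U (-t)` has strong derivative i V(t) Q U(-t) = i (V(t) U(-t))
K(t), a linear equation with bounded coefficients. Since the `K t` commute on [0,1], no time
ordering is needed: with S(t) the strong integral of K over [0,t], the operator exp(-iS(t)) has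
strong derivative -i exp(-iS(t)) K(t), and K(t) commutes with it. Hence V(t) U(-t) exp(-iS(t)) has
derivative zero on [0,1] and equals its initial value 1; at t = 1 this is the identity.

Three things carry the argument. Stone's theorem (`IsSelfAdjoint.exists_isUnitaryGroupOf`) supplies
both groups, as strong limits of exponentials of commuting bounded approximants. The equation for
V(t) U(-t) (`IsUnitaryGroupOf.hasDerivAt_mul_neg`) is computed on the domain of P and extended to
all vectors in integrated form. Finally, S is differentiable only strongly but Lipschitz in norm,
which is enough to differentiate its exponential (`HasDerivWithinAt.exp_apply`). -/

open Filter Topology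

/-! ### Strong convergence of bounded families of operators. -/

section StrongLimits

variable {𝕜 E : Type*} [NontriviallyNormedField 𝕜] [NormedAddCommGroup E] [NormedSpace 𝕜 E]
  {ι : Type*} {l : Filter ι} {F : ι → E →L[𝕜] E} {C : ℝ}

/-- A bounded family of operators that converges strongly converges along convergent vectors. -/
theorem tendsto_apply_of_bounded {G : E → E} (hC : ∀ i v, ‖F i v‖ ≤ C * ‖v‖) {g : ι → E} {x : E}
    (hF : Tendsto (fun i => F i x) l (𝓝 (G x))) (hg : Tendsto g l (𝓝 x)) :
    Tendsto (fun i => F i (g i)) l (𝓝 (G x)) := by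
  have h0 : Tendsto (fun i => F i (g i - x)) l (𝓝 0) := by
    refine squeeze_zero_norm (fun i => hC i _) ?_
    have h1 : Tendsto (fun i => ‖g i - x‖) l (𝓝 0) := by
      rw [← tendsto_iff_norm_sub_tendsto_zero]; exact hg
    simpa using h1.const_mul C
  simpa using h0.add hF

/-- A bounded sequence of operators that converges strongly on a dense set converges strongly. -/
theorem cauchySeq_apply_of_dense {F : ℕ → E →L[𝕜] E} (hC : ∀ i v, ‖F i v‖ ≤ ‖v‖) {s : Set E}
    (hs : Dense s) (hF : ∀ x ∈ s, CauchySeq fun i => F i x) (x : E) :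
    CauchySeq fun i => F i x := by
  rw [Metric.cauchySeq_iff']
  intro ε hε
  obtain ⟨y, hy, hxy⟩ := hs.exists_dist_lt x (show 0 < ε / 3 by positivity)
  obtain ⟨N, hN⟩ := Metric.cauchySeq_iff'.1 (hF y hy) (ε / 3) (by positivity)
  refine ⟨N, fun n hn => ?_⟩
  have hd : ∀ i, dist (F i x) (F i y) < ε / 3 := fun i => by
    rw [dist_eq_norm, ← map_sub]
    exact (hC i _).trans_lt (by rwa [← dist_eq_norm])
  have h1 := hd n
  have h2 := hd N
  have h3 := hN n hn
  have h4 := dist_triangle4 (F n x) (F n y) (F N y) (F N x)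
  rw [dist_comm (F N y)] at h4
  linarith

theorem tendsto_apply_of_dense {G : E →L[𝕜] E} (hC : ∀ i v, ‖F i v‖ ≤ ‖v‖)
    (hG : ∀ v, ‖G v‖ ≤ ‖v‖) {s : Set E}
    (hs : Dense s) (hF : ∀ x ∈ s, Tendsto (fun i => F i x) l (𝓝 (G x))) (x : E) :
    Tendsto (fun i => F i x) l (𝓝 (G x)) := by
  rw [Metric.tendsto_nhds]
  intro ε hε
  obtain ⟨y, hy, hxy⟩ := hs.exists_dist_lt x (show 0 < ε / 3 by positivity)
  filter_upwards [Metric.tendsto_nhds.1 (hF y hy) (ε / 3) (by positivity)] with i hi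
  have h1 : dist (F i x) (F i y) < ε / 3 := by
    rw [dist_eq_norm, ← map_sub]
    exact (hC i _).trans_lt (by rwa [← dist_eq_norm])
  have h2 : dist (G x) (G y) < ε / 3 := by
    rw [dist_eq_norm, ← map_sub]
    exact (hG _).trans_lt (by rwa [← dist_eq_norm])
  have h4 := dist_triangle4 (F i x) (F i y) (G y) (G x)
  rw [dist_comm (G y)] at h4
  linarith

end StrongLimits

/-! ### Graphs, resolvents and Yosida approximants of a self-adjoint operator. -/

section SelfAdjoint

variable {H : Type*} [NormedAddCommGroup H] [InnerProductSpace ℂ H] [CompleteSpace H]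
  {A : H →ₗ.[ℂ] H}

/-- A self-adjoint graph is its own adjoint. From left to right this is symmetry; from right to left
it is maximality, the tool for showing that a vector lies in the domain. -/
theorem LinearPMap.mem_graph_iff_of_isSelfAdjoint (hA : IsSelfAdjoint A) {x y : H} :
    (x, y) ∈ A.graph ↔ ∀ a b, (a, b) ∈ A.graph → ⟪b, x⟫_ℂ = ⟪a, y⟫_ℂ := by
  have h : A.graph = A.graph.adjoint := by
    rw [← LinearPMap.adjoint_graph_eq_graph_adjoint hA.dense_domain,
      LinearPMap.isSelfAdjoint_def.1 hA]
  conv_lhs => rw [h, Submodule.mem_adjoint_iff]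
  simp only [sub_eq_zero]

theorem LinearPMap.isSelfAdjoint_of_mem_graph_iff (hd : Dense (A.domain : Set H))
    (h : ∀ x y, (x, y) ∈ A.graph ↔ ∀ a b, (a, b) ∈ A.graph → ⟪b, x⟫_ℂ = ⟪a, y⟫_ℂ) :
    IsSelfAdjoint A := by
  rw [LinearPMap.isSelfAdjoint_def]
  refine LinearPMap.eq_of_eq_graph ?_
  rw [LinearPMap.adjoint_graph_eq_graph_adjoint hd]
  ext ⟨x, y⟩
  rw [Submodule.mem_adjoint_iff, h]
  simp only [sub_eq_zero]

/-- The cross term vanishes because ⟪x, y⟫ is real. For ε ≠ 0 this bounds 1 + iεA from below, and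
both signs of ε are used. -/
theorem IsSelfAdjoint.norm_add_smul_sq (hA : IsSelfAdjoint A) {x y : H} (h : (x, y) ∈ A.graph)
    (ε : ℝ) : ‖x + (Complex.I * ε) • y‖ ^ 2 = ‖x‖ ^ 2 + ε ^ 2 * ‖y‖ ^ 2 := by
  have h1 := (LinearPMap.mem_graph_iff_of_isSelfAdjoint hA).1 h x y h
  have h2 : (⟪x, y⟫_ℂ).im = 0 := by
    have := congrArg Complex.im h1
    rw [← inner_conj_symm, Complex.conj_im] at this
    linarith
  rw [@norm_add_sq ℂ, inner_smul_right, norm_smul, mul_pow]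
  simp [h2]

/-- The resolvent `(1 + iεA)⁻¹` of a self-adjoint operator. -/
theorem IsSelfAdjoint.exists_resolvent (hA : IsSelfAdjoint A) {ε : ℝ} (hε : ε ≠ 0) :
    ∃ J : H →L[ℂ] H, (∀ z, ‖J z‖ ≤ ‖z‖) ∧
      (∀ z, ∃ y, (J z, y) ∈ A.graph ∧ J z + (Complex.I * ε) • y = z) ∧
      ∀ x y, (x, y) ∈ A.graph → J (x + (Complex.I * ε) • y) = x := by
  have hIε : Complex.I * ε ≠ 0 := mul_ne_zero Complex.I_ne_zero (by exact_mod_cast hε)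
  have hcl : IsClosed (A.graph : Set (H × H)) := hA.isClosed
  have : CompleteSpace A.graph := hcl.completeSpace_coe
  let φ : H × H →L[ℂ] H := ContinuousLinearMap.fst ℂ H H +
    (Complex.I * ε) • ContinuousLinearMap.snd ℂ H H
  let ψ : A.graph →L[ℂ] H := φ.comp A.graph.subtypeL
  have hψ : ∀ p : A.graph, ψ p = p.1.1 + (Complex.I * ε) • p.1.2 := fun p => rfl
  have hψn : ∀ p : A.graph, ‖ψ p‖ ^ 2 = ‖p.1.1‖ ^ 2 + ε ^ 2 * ‖p.1.2‖ ^ 2 := fun p => by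
    rw [hψ]; exact hA.norm_add_smul_sq p.2 ε
  have hfst : ∀ p : A.graph, ‖p.1.1‖ ≤ ‖ψ p‖ := fun p => by
    refine le_of_sq_le_sq ?_ (norm_nonneg _)
    rw [hψn]; nlinarith [sq_nonneg (ε * ‖p.1.2‖)]
  have hsnd : ∀ p : A.graph, |ε| * ‖p.1.2‖ ≤ ‖ψ p‖ := fun p => by
    refine le_of_sq_le_sq ?_ (norm_nonneg _)
    rw [hψn, mul_pow, sq_abs]; nlinarith [sq_nonneg ‖p.1.1‖]
  have hεp : 0 < |ε| := abs_pos.2 hε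
  -- On the complete space `A.graph`, the map 1 + iεA is bounded below in the graph norm, so its
  -- range is closed.
  have hanti : AntilipschitzWith (Real.toNNReal (1 + |ε|⁻¹)) ψ := by
    refine ψ.antilipschitz_of_bound fun p => ?_
    rw [Real.coe_toNNReal _ (by positivity)]
    have h2 : ‖p.1.2‖ ≤ |ε|⁻¹ * ‖ψ p‖ := by
      rw [le_inv_mul_iff₀ hεp]; exact hsnd p
    have h1 := hfst p
    have h3 : ‖p‖ = max ‖p.1.1‖ ‖p.1.2‖ := rfl
    rw [h3]
    refine max_le ?_ ?_
    · have : 0 ≤ |ε|⁻¹ * ‖ψ p‖ := by positivity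
      linarith
    · linarith [norm_nonneg (ψ p)]
  have hrange : IsClosed (Set.range ψ) := hanti.isClosed_range ψ.uniformContinuous
  have hsurj : Function.Surjective ψ := by
    have hc : IsClosed (LinearMap.range (ψ : A.graph →ₗ[ℂ] H) : Set H) := by
      rw [LinearMap.coe_range]; exact hrange
    have : CompleteSpace (LinearMap.range (ψ : A.graph →ₗ[ℂ] H)) := hc.completeSpace_coe
    have htop : LinearMap.range (ψ : A.graph →ₗ[ℂ] H) = ⊤ := by
      rw [← Submodule.orthogonal_eq_bot_iff, Submodule.eq_bot_iff]
      intro w hw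
      rw [Submodule.mem_orthogonal] at hw
      -- A vector orthogonal to the range satisfies (1 - iεA)w = 0; the norm identity for -ε then
      -- forces w = 0.
      have hg : (w, (Complex.I * ε)⁻¹ • w) ∈ A.graph := by
        rw [LinearPMap.mem_graph_iff_of_isSelfAdjoint hA]
        intro a b hab
        have := hw _ ⟨⟨(a, b), hab⟩, rfl⟩
        have h' : ⟪a + (Complex.I * ε) • b, w⟫_ℂ = 0 := this
        rw [inner_add_left, inner_smul_left] at h'
        rw [inner_smul_right, eq_inv_mul_iff_mul_eq₀ hIε]
        simp only [map_mul, Complex.conj_I, Complex.conj_ofReal] at h'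
        linear_combination -h'
      have h0 := hA.norm_add_smul_sq hg (-ε)
      have h1 : w + (Complex.I * ((-ε : ℝ) : ℂ)) • (Complex.I * (ε : ℂ))⁻¹ • w = 0 := by
        rw [smul_smul, Complex.ofReal_neg, mul_neg, neg_mul, mul_inv_cancel₀ hIε]
        simp
      rw [h1] at h0
      have h2 : ‖w‖ ^ 2 = 0 := by
        have := sq_nonneg ‖w‖
        have h3 : 0 ≤ (-ε) ^ 2 * ‖(Complex.I * (ε : ℂ))⁻¹ • w‖ ^ 2 := by positivity
        simp only [norm_zero] at h0
        linarith
      simpa using h2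
    exact LinearMap.range_eq_top.1 htop
  let e : A.graph ≃ₗ[ℂ] H := LinearEquiv.ofBijective (ψ : A.graph →ₗ[ℂ] H)
    ⟨hanti.injective, hsurj⟩
  have he : ∀ p, e p = ψ p := fun p => rfl
  have hes : ∀ z, ψ (e.symm z) = z := fun z => e.apply_symm_apply z
  let J₀ : H →ₗ[ℂ] H := (LinearMap.fst ℂ H H).comp (A.graph.subtype.comp e.symm.toLinearMap)
  have hJ₀ : ∀ z, J₀ z = (e.symm z).1.1 := fun z => rfl
  have hJn : ∀ z, ‖J₀ z‖ ≤ 1 * ‖z‖ := fun z => by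
    have := hfst (e.symm z)
    rw [hes] at this
    rw [one_mul]; exact this
  refine ⟨J₀.mkContinuous 1 hJn, fun z => by simpa using hJn z, fun z => ?_, fun x y hxy => ?_⟩
  · exact ⟨(e.symm z).1.2, (e.symm z).2, hes z⟩
  · have : e.symm (x + (Complex.I * ε) • y) = ⟨(x, y), hxy⟩ := by
      rw [LinearEquiv.symm_apply_eq]; rfl
    change (e.symm (x + (Complex.I * ε) • y)).1.1 = x
    rw [this]

/-- A self-adjoint operator is the strong limit, on its domain, of commuting bounded self-adjoint
operators (its Yosida approximants). -/
theorem IsSelfAdjoint.exists_yosida (hA : IsSelfAdjoint A) :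
    ∃ B : ℕ → H →L[ℂ] H, (∀ n, IsSelfAdjoint (B n)) ∧ (∀ m n, Commute (B m) (B n)) ∧
      ∀ x y, (x, y) ∈ A.graph → Tendsto (fun n => B n x) atTop (𝓝 y) := by
  -- The resolvent is made total in ε, with value 0 at ε = 0, so that `J (-ε)` can be used freely.
  have hex : ∀ ε : ℝ, ∃ J : H →L[ℂ] H, ε ≠ 0 → (∀ z, ‖J z‖ ≤ ‖z‖) ∧
      (∀ z, ∃ y, (J z, y) ∈ A.graph ∧ J z + (Complex.I * ε) • y = z) ∧
      ∀ x y, (x, y) ∈ A.graph → J (x + (Complex.I * ε) • y) = x := fun ε => by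
    by_cases hε : ε = 0
    · exact ⟨0, fun h => absurd hε h⟩
    · obtain ⟨J, hJ⟩ := hA.exists_resolvent hε
      exact ⟨J, fun _ => hJ⟩
  choose J hJ using hex
  have hI : ∀ {ε : ℝ}, ε ≠ 0 → Complex.I * (ε : ℂ) ≠ 0 := fun h =>
    mul_ne_zero Complex.I_ne_zero (by exact_mod_cast h)
  -- The resolvent commutes with A: b = A(Jx) equals (iε)⁻¹(x - Jx), which lies in the domain, and
  -- (1 + iεA)b = y, so b = Jy.
  have hgraph : ∀ {ε : ℝ}, ε ≠ 0 → ∀ {x y}, (x, y) ∈ A.graph → (J ε x, J ε y) ∈ A.graph := by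
    intro ε hε x y hxy
    obtain ⟨b, hab, hx⟩ := (hJ ε hε).2.1 x
    have h1 : (b, (Complex.I * ε)⁻¹ • (y - b)) ∈ A.graph := by
      have h2 := A.graph.smul_mem (Complex.I * ε)⁻¹ (A.graph.sub_mem hxy hab)
      have h3 : (Complex.I * ε)⁻¹ • (x - J ε x) = b := by
        rw [inv_smul_eq_iff₀ (hI hε)]
        exact sub_eq_of_eq_add' hx.symm
      rw [Prod.mk_sub_mk, Prod.smul_mk, h3] at h2
      exact h2
    have h4 := (hJ ε hε).2.2 _ _ h1
    rw [smul_inv_smul₀ (hI hε), add_sub_cancel] at h4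
    rw [h4]; exact hab
  have hcomm : ∀ {ε δ : ℝ}, ε ≠ 0 → δ ≠ 0 → Commute (J ε) (J δ) := by
    intro ε δ hε hδ
    refine ContinuousLinearMap.ext fun z => ?_
    obtain ⟨y, hy, hz⟩ := (hJ δ hδ).2.1 z
    have h1 := (hJ δ hδ).2.2 _ _ (hgraph hε hy)
    have h2 : J ε (J δ z) + (Complex.I * δ) • J ε y = J ε z := by
      rw [← map_smul, ← map_add, hz]
    rw [h2] at h1
    exact h1.symm
  have hadj : ∀ {ε : ℝ}, ε ≠ 0 → star (J ε) = J (-ε) := by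
    intro ε hε
    rw [ContinuousLinearMap.star_eq_adjoint]
    symm
    rw [ContinuousLinearMap.eq_adjoint_iff]
    intro w z
    obtain ⟨y, hy, hz⟩ := (hJ ε hε).2.1 z
    obtain ⟨y', hy', hw⟩ := (hJ (-ε) (neg_ne_zero.2 hε)).2.1 w
    have h := (LinearPMap.mem_graph_iff_of_isSelfAdjoint hA).1 hy _ _ hy'
    conv_lhs => rw [← hz]
    conv_rhs => rw [← hw]
    rw [inner_add_left, inner_add_right, inner_smul_left, inner_smul_right, h]
    simp
  have hgr : ∀ {ε : ℝ}, ε ≠ 0 → ∀ {x y}, (x, y) ∈ A.graph →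
      J ε x = x - (Complex.I * ε) • J ε y := by
    intro ε hε x y hxy
    have := (hJ ε hε).2.2 _ _ hxy
    rw [map_add, map_smul] at this
    exact eq_sub_of_add_eq this
  have hlim : ∀ {ε : ℕ → ℝ}, (∀ n, ε n ≠ 0) → Tendsto ε atTop (𝓝 0) → ∀ x,
      Tendsto (fun n => J (ε n) x) atTop (𝓝 x) := by
    intro ε hε hlim x
    refine tendsto_apply_of_dense (G := 1) (fun n => (hJ _ (hε n)).1) (fun v => le_rfl)
      hA.dense_domain (fun x hx => ?_) x
    obtain ⟨y, hxy⟩ := LinearPMap.mem_domain_iff.1 hx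
    have h1 : Tendsto (fun n => (Complex.I * ε n) • J (ε n) y) atTop (𝓝 0) := by
      refine squeeze_zero_norm (a := fun n => |ε n| * ‖y‖) (fun n => ?_) ?_
      · rw [norm_smul]
        simp only [norm_mul, Complex.norm_I, one_mul, Complex.norm_real, Real.norm_eq_abs]
        exact mul_le_mul_of_nonneg_left ((hJ _ (hε n)).1 y) (abs_nonneg _)
      · simpa using hlim.abs.mul_const ‖y‖
    have h2 : (fun n => J (ε n) x) = fun n => x - (Complex.I * ε n) • J (ε n) y :=
      funext fun n => hgr (hε n) hxy
    rw [h2]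
    simpa using h1.const_sub x
  let ε : ℕ → ℝ := fun n => 1 / ((n : ℝ) + 1)
  have hε : ∀ n, ε n ≠ 0 := fun n => by positivity
  have hε' : ∀ n, -ε n ≠ 0 := fun n => neg_ne_zero.2 (hε n)
  have hε0 : Tendsto ε atTop (𝓝 0) := tendsto_one_div_add_atTop_nhds_zero_nat
  -- The approximant is A(1 + ε²A²)⁻¹. Combining the resolvents at ε and -ε makes it self-adjoint,
  -- since the adjoint swaps them; on the domain it sends x to the mean of the two resolvents
  -- applied to Ax.
  refine ⟨fun n => (2 * (Complex.I * ε n))⁻¹ • (J (-ε n) - J (ε n)), fun n => ?_, fun m n => ?_,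
    fun x y hxy => ?_⟩
  · rw [isSelfAdjoint_iff, star_smul, star_sub, hadj (hε n), hadj (hε' n), neg_neg]
    simp only [star_inv₀, star_mul', Complex.star_def, Complex.conj_I, Complex.conj_ofReal,
      map_ofNat]
    rw [neg_mul, mul_neg, inv_neg, neg_smul, ← smul_neg, neg_sub]
  · refine Commute.smul_left (Commute.smul_right ?_ _) _
    exact ((hcomm (hε' m) (hε' n)).sub_right (hcomm (hε' m) (hε n))).sub_left
      ((hcomm (hε m) (hε' n)).sub_right (hcomm (hε m) (hε n)))
  · have h1 : ∀ n, ((2 * (Complex.I * ε n))⁻¹ • (J (-ε n) - J (ε n))) x =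
        (2⁻¹ : ℂ) • (J (-ε n) y + J (ε n) y) := fun n => by
      have h2 : (J (-ε n) - J (ε n)) x = (Complex.I * ε n) • (J (-ε n) y + J (ε n) y) := by
        rw [sub_apply, hgr (hε' n) hxy, hgr (hε n) hxy]
        push_cast
        module
      rw [smul_apply, h2, mul_inv, mul_smul, inv_smul_smul₀ (hI (hε n))]
    simp only [h1]
    have h3 := ((hlim hε' (by simpa using hε0.neg) y).add (hlim hε hε0 y)).const_smul (2⁻¹ : ℂ)
    have h4 : (2⁻¹ : ℂ) • (y + y) = y := by module
    rwa [h4] at h3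

end SelfAdjoint

/-! ### Stone's theorem. -/

section Stone

variable {H : Type*} [NormedAddCommGroup H] [InnerProductSpace ℂ H] [CompleteSpace H]

section Bounded

variable {B C : H →L[ℂ] H}

theorem IsSelfAdjoint.exp_I_smul_mem_unitary (hB : IsSelfAdjoint B) :
    NormedSpace.exp (Complex.I • B) ∈ unitary (H →L[ℂ] H) := by
  let _ : NormedAlgebra ℚ (H →L[ℂ] H) := NormedAlgebra.restrictScalars ℚ ℂ _
  exact NormedSpace.exp_mem_unitary_of_mem_skewAdjoint hB.I_smul_mem_skewAdjoint

theorem IsSelfAdjoint.exp_smul_I_smul_mem_unitary (hB : IsSelfAdjoint B) (t : ℝ) :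
    NormedSpace.exp (t • Complex.I • B) ∈ unitary (H →L[ℂ] H) := by
  rw [smul_comm]
  exact IsSelfAdjoint.exp_I_smul_mem_unitary (IsSelfAdjoint.smul (IsSelfAdjoint.all t) hB)

theorem hasDerivAt_exp_smul_apply (D : H →L[ℂ] H) (x : H) (t : ℝ) :
    HasDerivAt (fun t : ℝ => NormedSpace.exp (t • D) x) (NormedSpace.exp (t • D) (D x)) t := by
  have h := hasDerivAt_exp_smul_const (𝕂 := ℝ) D t
  have h2 := (((ContinuousLinearMap.apply ℂ H x).restrictScalars ℝ).hasFDerivAt).comp_hasDerivAt t h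
  exact h2

theorem IsSelfAdjoint.norm_exp_smul_apply_sub_self_le (hB : IsSelfAdjoint B) (t : ℝ) (x : H) :
    ‖NormedSpace.exp (t • Complex.I • B) x - x‖ ≤ ‖B x‖ * |t| := by
  have h := Convex.norm_image_sub_le_of_norm_hasDerivWithin_le (s := Set.univ) (C := ‖B x‖)
    (fun s _ => (hasDerivAt_exp_smul_apply (Complex.I • B) x s).hasDerivWithinAt)
    (fun s _ => by
      rw [ContinuousLinearMap.norm_map_of_mem_unitary (hB.exp_smul_I_smul_mem_unitary s)]
      simp [norm_smul]) convex_univ (Set.mem_univ 0) (Set.mem_univ t)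
  simpa using h

/-- Commutation gives e^{itB} = e^{itC} e^{it(B-C)}, and the unitary factor drops out of the norm.
Convergence of the generators on a vector thus yields convergence of the exponentials on it. -/
theorem IsSelfAdjoint.norm_exp_smul_apply_sub_le (hB : IsSelfAdjoint B) (hC : IsSelfAdjoint C)
    (hBC : Commute B C) (t : ℝ) (x : H) :
    ‖NormedSpace.exp (t • Complex.I • B) x - NormedSpace.exp (t • Complex.I • C) x‖ ≤
      ‖B x - C x‖ * |t| := by
  let _ : NormedAlgebra ℚ (H →L[ℂ] H) := NormedAlgebra.restrictScalars ℚ ℂ _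
  have h1 : t • Complex.I • B = t • Complex.I • C + t • Complex.I • (B - C) := by module
  have hc : Commute (t • Complex.I • C) (t • Complex.I • (B - C)) :=
    (((hBC.symm.sub_right (Commute.refl C)).smul_right _).smul_right _).smul_left _ |>.smul_left _
  rw [h1, NormedSpace.exp_add_of_commute hc, mul_apply_eq_comp, ← map_sub,
    ContinuousLinearMap.norm_map_of_mem_unitary (hC.exp_smul_I_smul_mem_unitary t)]
  exact (hB.sub hC).norm_exp_smul_apply_sub_self_le t x

end Bounded

variable {A : H →ₗ.[ℂ] H}

/-- **Stone's theorem**, existence: a self-adjoint operator generates a strongly continuous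
one-parameter unitary group. -/
theorem IsSelfAdjoint.exists_isUnitaryGroupOf (hA : IsSelfAdjoint A) :
    ∃ U, IsUnitaryGroupOf A U := by
  let _ : NormedAlgebra ℚ (H →L[ℂ] H) := NormedAlgebra.restrictScalars ℚ ℂ _
  obtain ⟨B, hB, hBB, hBA⟩ := hA.exists_yosida
  let E : ℕ → ℝ → H →L[ℂ] H := fun n t => NormedSpace.exp (t • Complex.I • B n)
  have hEu : ∀ n t, E n t ∈ unitary (H →L[ℂ] H) := fun n t => (hB n).exp_smul_I_smul_mem_unitary t
  have hEn : ∀ n t x, ‖E n t x‖ = ‖x‖ := fun n t => ContinuousLinearMap.norm_map_of_mem_unitary (hEu n t)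
  have hE0 : ∀ n, E n 0 = 1 := fun n => by simp [E]
  have hEadd : ∀ n s t, E n (s + t) = E n s * E n t := fun n s t => by
    simp only [E]
    rw [add_smul, NormedSpace.exp_add_of_commute]
    exact ((Commute.refl _).smul_right _).smul_left _
  have hEstar : ∀ n t, star (E n t) = E n (-t) := fun n t => by
    rw [← one_mul (star (E n t)), ← hE0 n, ← neg_add_cancel t, hEadd, mul_assoc,
      Unitary.mul_star_self_of_mem (hEu n t), mul_one]
  have hdom : ∀ x ∈ (A.domain : Set H), ∃ y, (x, y) ∈ A.graph := fun x hx =>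
    LinearPMap.mem_domain_iff.1 hx
  have hcauchy : ∀ t x, CauchySeq fun n => E n t x := fun t x => by
    refine cauchySeq_apply_of_dense (fun n v => (hEn n t v).le) hA.dense_domain (fun x hx => ?_) x
    obtain ⟨y, hxy⟩ := hdom x hx
    have hc : CauchySeq fun n => B n x := (hBA x y hxy).cauchySeq
    rw [Metric.cauchySeq_iff] at hc ⊢
    intro ε hε
    obtain ⟨N, hN⟩ := hc (ε / (|t| + 1)) (by positivity)
    refine ⟨N, fun m hm n hn => ?_⟩
    have h1 := hN m hm n hn
    have h2 := (hB m).norm_exp_smul_apply_sub_le (hB n) (hBB m n) t x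
    rw [dist_eq_norm] at h1 ⊢
    rw [lt_div_iff₀ (by positivity)] at h1
    have h3 := norm_nonneg (B m x - B n x)
    refine h2.trans_lt ?_
    linarith
  choose L hL using fun t x => cauchySeq_tendsto_of_complete (hcauchy t x)
  have hLe : ∀ t, ∃ U : H →L[ℂ] H, ∀ x, U x = L t x := fun t => by
    refine ⟨continuousLinearMapOfTendsto (fun n => E n t) (f := L t) (tendsto_pi_nhds.2 (hL t)),
      fun x => rfl⟩
  choose U hU using hLe
  have hlim : ∀ t x, Tendsto (fun n => E n t x) atTop (𝓝 (U t x)) := fun t x => by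
    rw [hU]; exact hL t x
  have hUn : ∀ t x, ‖U t x‖ = ‖x‖ := fun t x => by
    refine tendsto_nhds_unique (hlim t x).norm ?_
    simp only [hEn]; exact tendsto_const_nhds
  have hU0 : U 0 = 1 := by
    ext x
    refine tendsto_nhds_unique (hlim 0 x) ?_
    simp only [hE0]; exact tendsto_const_nhds
  have hUadd : ∀ s t, U (s + t) = U s * U t := fun s t => by
    ext x
    refine tendsto_nhds_unique (hlim (s + t) x) ?_
    simp only [hEadd, mul_apply_eq_comp]
    exact tendsto_apply_of_bounded (F := fun n => E n s) (G := U s) (C := 1)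
      (fun n v => by rw [one_mul, hEn]) (hlim s (U t x)) (hlim t x)
  have hUstar : ∀ t, star (U t) = U (-t) := fun t => by
    rw [ContinuousLinearMap.star_eq_adjoint]
    symm
    rw [ContinuousLinearMap.eq_adjoint_iff]
    intro x y
    have h1 := (hlim (-t) x).inner (𝕜 := ℂ) (tendsto_const_nhds (x := y))
    have h2 := (tendsto_const_nhds (x := x)).inner (𝕜 := ℂ) (hlim t y)
    refine tendsto_nhds_unique h1 (h2.congr fun n => ?_)
    rw [← hEstar, ContinuousLinearMap.star_eq_adjoint, ContinuousLinearMap.adjoint_inner_left]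
  have hUu : ∀ t, U t ∈ unitary (H →L[ℂ] H) := fun t => by
    rw [Unitary.mem_iff, hUstar, ← hUadd, ← hUadd]
    simp [hU0]
  have hUcont : ∀ x, Continuous fun t => U t x := fun x => by
    refine continuous_iff_continuousAt.2 fun t => ?_
    refine tendsto_apply_of_dense (F := U) (fun s v => (hUn s v).le) (fun v => (hUn t v).le)
      hA.dense_domain (fun x hx => ?_) x
    obtain ⟨y, hxy⟩ := hdom x hx
    have hle : ∀ s, ‖U s x - U t x‖ ≤ ‖y‖ * |s - t| := fun s => by
      have h1 : ‖U s x - U t x‖ = ‖U (s - t) x - x‖ := by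
        conv_lhs => rw [← add_sub_cancel t s, hUadd, mul_apply_eq_comp, ← map_sub, hUn]
      rw [h1]
      exact le_of_tendsto_of_tendsto ((hlim _ x).sub_const x).norm
        ((hBA x y hxy).norm.mul_const _)
        (Eventually.of_forall fun n => (hB n).norm_exp_smul_apply_sub_self_le _ x)
    rw [tendsto_iff_norm_sub_tendsto_zero]
    refine squeeze_zero (fun _ => norm_nonneg _) hle ?_
    have : Continuous fun s => ‖y‖ * |s - t| := by fun_prop
    simpa using this.tendsto t
  -- Derivatives need not pass to a strong limit, so the integrated equation is passed to the limit
  -- instead, dominated by a bound on ‖B n x‖.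
  have hUint : ∀ x y, (x, y) ∈ A.graph → ∀ t, U t x - x = ∫ s in (0 : ℝ)..t, U s (Complex.I • y) :=
    fun x y hxy t => by
    have hEc : ∀ n v, Continuous fun s => E n s v := fun n v =>
      continuous_iff_continuousAt.2 fun s => (hasDerivAt_exp_smul_apply _ v s).continuousAt
    have h1 : ∀ n, E n t x - x = ∫ s in (0 : ℝ)..t, E n s (Complex.I • B n x) := fun n => by
      have := intervalIntegral.integral_eq_sub_of_hasDerivAt (a := 0) (b := t)
        (fun s _ => hasDerivAt_exp_smul_apply (Complex.I • B n) x s)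
        ((hEc n _).intervalIntegrable _ _)
      refine Eq.trans ?_ this.symm
      simp [E]
    refine tendsto_nhds_unique ((hlim t x).sub_const x) ?_
    simp only [h1]
    obtain ⟨K, hK⟩ := (hBA x y hxy).norm.bddAbove_range
    refine intervalIntegral.tendsto_integral_filter_of_dominated_convergence (fun _ => K)
      (Eventually.of_forall fun n => (hEc n _).aestronglyMeasurable)
      (Eventually.of_forall fun n => Eventually.of_forall fun s _ => ?_) (by simp)
      (Eventually.of_forall fun s _ => ?_)
    · rw [hEn, norm_smul, Complex.norm_I, one_mul]
      exact hK ⟨n, rfl⟩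
    · exact tendsto_apply_of_bounded (F := fun n => E n s) (G := U s) (C := 1)
        (fun n v => by rw [one_mul, hEn]) (hlim s _) ((hBA x y hxy).const_smul _)
  have hUder : ∀ x y, (x, y) ∈ A.graph → HasDerivAt (fun t => U t x) (Complex.I • y) 0 :=
    fun x y hxy => by
    have h1 := intervalIntegral.integral_hasDerivAt_right (a := 0) (b := 0)
      (f := fun s => U s (Complex.I • y)) (by simp)
      ((hUcont _).stronglyMeasurableAtFilter _ _) (hUcont _).continuousAt
    have h2 := h1.const_add x
    rw [hU0] at h2
    refine HasDerivAt.congr_of_eventuallyEq h2 (Eventually.of_forall fun t => ?_)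
    simp only [← hUint x y hxy t]
    abel
  refine ⟨U, hUu, hU0, hUadd, hUcont, fun x y => ⟨hUder x y, fun h => ?_⟩⟩
  -- Conversely, differentiating ⟪a, U t x⟫ = ⟪U (-t) a, x⟫ at 0 shows that (x, y) is symmetric
  -- against the whole graph, and maximality applies.
  rw [LinearPMap.mem_graph_iff_of_isSelfAdjoint hA]
  intro a b hab
  have h1 : HasDerivAt (fun t : ℝ => ⟪a, U t x⟫_ℂ) ⟪a, Complex.I • y⟫_ℂ 0 := by
    have := (((innerSL ℂ a).restrictScalars ℝ).hasFDerivAt).comp_hasDerivAt (0 : ℝ) h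
    exact this
  have h2 : HasDerivAt (fun t : ℝ => U (-t) a) (-(Complex.I • b)) 0 := by
    have h3 : HasDerivAt (fun t => U t a) (Complex.I • b) (-0) := by
      simpa using hUder a b hab
    have := h3.scomp (0 : ℝ) (hasDerivAt_neg (0 : ℝ))
    rw [neg_one_smul] at this
    exact this
  have h4 : HasDerivAt (fun t : ℝ => ⟪U (-t) a, x⟫_ℂ) ⟪-(Complex.I • b), x⟫_ℂ 0 := by
    have := h2.inner ℂ (hasDerivAt_const (0 : ℝ) x)
    simpa using this
  have h5 : (fun t : ℝ => ⟪a, U t x⟫_ℂ) = fun t => ⟪U (-t) a, x⟫_ℂ := by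
    funext t
    rw [← hUstar, ContinuousLinearMap.star_eq_adjoint, ContinuousLinearMap.adjoint_inner_left]
  rw [h5] at h1
  have h6 := h4.unique h1
  rw [inner_neg_left, inner_smul_left, inner_smul_right, Complex.conj_I, neg_mul, neg_neg] at h6
  exact mul_left_cancel₀ Complex.I_ne_zero h6

theorem IsSelfAdjoint.isUnitaryGroupOf_expI (hA : IsSelfAdjoint A) :
    IsUnitaryGroupOf A (expI A) := by
  obtain ⟨U, hU⟩ := hA.exists_isUnitaryGroupOf
  rwa [hU.expI_eq hA]

end Stone

/-! ### Strong calculus and bounded perturbations. -/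

section Perturbation

variable {H : Type*} [NormedAddCommGroup H] [InnerProductSpace ℂ H]

section StrongCalculus

variable {F : ℝ → H →L[ℂ] H} {C : ℝ}

/-- The product rule for a strongly differentiable bounded family of operators applied to a
differentiable family of vectors. -/
theorem HasDerivWithinAt.apply_of_bounded (hC : ∀ t v, ‖F t v‖ ≤ C * ‖v‖) {g : ℝ → H}
    {g' w : H} {s : Set ℝ} {t : ℝ} (hF : HasDerivWithinAt (fun r => F r (g t)) w s t)
    (hFc : ContinuousWithinAt (fun r => F r g') s t) (hg : HasDerivWithinAt g g' s t) :
    HasDerivWithinAt (fun r => F r (g r)) (w + F t g') s t := by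
  rw [hasDerivWithinAt_iff_tendsto_slope] at hF hg ⊢
  have h1 := tendsto_apply_of_bounded (G := F t) hC
    (hFc.tendsto.mono_left (nhdsWithin_mono t Set.sdiff_subset)) hg
  -- The slope splits as that of F at the fixed vector g(t), plus F(r) applied to the slope of g.
  refine (hF.add h1).congr fun r => ?_
  have h2 : F r ((r - t)⁻¹ • (g r - g t)) = (r - t)⁻¹ • F r (g r - g t) :=
    ((F r).restrictScalars ℝ).map_smul _ _
  simp only [slope_def_module, h2, ← smul_add, map_sub]
  congr 1
  abel

theorem exists_hasStrongIntegral (hC : ∀ t v, ‖F t v‖ ≤ C * ‖v‖)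
    (hF : ∀ x, Continuous fun t => F t x) (a b : ℝ) : ∃ T, HasStrongIntegral F a b T := by
  have hi : ∀ x, IntervalIntegrable (fun t => F t x) MeasureTheory.volume a b := fun x =>
    (hF x).intervalIntegrable a b
  let T : H →ₗ[ℂ] H :=
    { toFun := fun x => ∫ t in a..b, F t x
      map_add' := fun x y => by
        simp only [map_add]
        exact intervalIntegral.integral_add (hi x) (hi y)
      map_smul' := fun c x => by
        simp only [map_smul, RingHom.id_apply]
        exact intervalIntegral.integral_smul c _ }
  refine ⟨T.mkContinuous (C * |b - a|) fun x => ?_, fun x => ⟨hi x, rfl⟩⟩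
  refine (intervalIntegral.norm_integral_le_of_norm_le_const fun t _ => hC t x).trans_eq ?_
  ring

variable [CompleteSpace H]

theorem hasDerivAt_integral_of_continuous {f : ℝ → H} (hf : Continuous f) (a t : ℝ) :
    HasDerivAt (fun t => ∫ s in a..t, f s) (f t) t :=
  intervalIntegral.integral_hasDerivAt_right (hf.intervalIntegrable _ _)
    (hf.stronglyMeasurableAtFilter _ _) hf.continuousAt

/-- A bounded operator passes through the vector-valued integral. Applied twice, this carries the
commutation of the conjugates over to their integrals. -/
theorem HasStrongIntegral.commute {T S : H →L[ℂ] H} {a b : ℝ} (hT : HasStrongIntegral F a b T)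
    (hS : ∀ t ∈ Set.uIcc a b, Commute S (F t)) : Commute S T := by
  refine ContinuousLinearMap.ext fun x => ?_
  rw [mul_apply_eq_comp, mul_apply_eq_comp, (hT x).2, (hT (S x)).2,
    ← S.intervalIntegral_comp_comm (hT x).1]
  refine intervalIntegral.integral_congr fun t ht => ?_
  exact DFunLike.congr_fun (hS t ht) x

/-- The derivative of the exponential of a commuting, norm-Lipschitz and strongly differentiable
family of operators. -/
theorem HasDerivWithinAt.exp_apply {S : ℝ → H →L[ℂ] H} {x w : H} {s : Set ℝ} {t : ℝ} (ht : t ∈ s)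
    (hcomm : ∀ r ∈ s, Commute (S t) (S r)) (hL : (fun r => S r - S t) =O[𝓝[s] t] fun r => r - t)
    (hS : HasDerivWithinAt (fun r => S r x) w s t) :
    HasDerivWithinAt (fun r => NormedSpace.exp (S r) x) (NormedSpace.exp (S t) w) s t := by
  let _ : NormedAlgebra ℚ (H →L[ℂ] H) := NormedAlgebra.restrictScalars ℚ ℂ _
  have hD0 : Tendsto (fun r => S r - S t) (𝓝[s] t) (𝓝 0) := by
    refine hL.trans_tendsto ?_
    have : Tendsto (fun r => r - t) (𝓝 t) (𝓝 0) := by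
      have : Continuous fun r : ℝ => r - t := by fun_prop
      simpa using this.tendsto t
    exact this.mono_left nhdsWithin_le_nhds
  have h1 := (hasFDerivAt_exp_zero (𝕂 := ℂ) (𝔸 := H →L[ℂ] H)).isLittleO
  have h2 := (h1.comp_tendsto hD0).trans_isBigO
    (show ((fun A => A - 0) ∘ fun r => S r - S t) =O[𝓝[s] t] fun r => r - t by
      simpa [Function.comp_def] using hL)
  -- The Lipschitz bound makes exp(D) - 1 - D, with D = S r - S t, of size o(r - t) in norm; only
  -- the linear term D needs strong differentiability.
  have h3 : (fun r => NormedSpace.exp (S r - S t) x - x - (S r - S t) x) =o[𝓝[s] t]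
      fun r => r - t := by
    refine Asymptotics.IsBigO.trans_isLittleO (Asymptotics.IsBigO.of_bound ‖x‖
      (Eventually.of_forall fun r => ?_)) h2
    have h4 := (NormedSpace.exp (S r - S t) - 1 - (S r - S t)).le_opNorm x
    simpa [mul_comm] using h4
  have h5 : HasDerivWithinAt (fun r => NormedSpace.exp (S r - S t) x - x - (S r - S t) x) 0 s t := by
    rw [hasDerivWithinAt_iff_isLittleO]
    simpa using h3
  have h6 : HasDerivWithinAt (fun r => NormedSpace.exp (S r - S t) x) w s t := by
    have h7 := (h5.add (hS.sub_const (S t x))).add_const x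
    rw [zero_add] at h7
    refine h7.congr (fun r _ => ?_) ?_ <;> simp
  have h8 : HasDerivWithinAt (fun r => NormedSpace.exp (S t) (NormedSpace.exp (S r - S t) x))
      (NormedSpace.exp (S t) w) s t :=
    ((NormedSpace.exp (S t)).restrictScalars ℝ).hasFDerivAt.comp_hasDerivWithinAt t h6
  -- Commutation factors the exponential and reduces the derivative at t to that of exp at 0.
  have h9 : ∀ r ∈ s, NormedSpace.exp (S r) x =
      NormedSpace.exp (S t) (NormedSpace.exp (S r - S t) x) := fun r hr => by
    rw [← mul_apply_eq_comp, ← NormedSpace.exp_add_of_commute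
      ((hcomm r hr).sub_right (Commute.refl _)), add_sub_cancel]
  exact h8.congr h9 (h9 t ht)

end StrongCalculus

variable {P : H →ₗ.[ℂ] H} {Q : H →L[ℂ] H}

/-- The graph of P + Q is a shear of the graph of P, so questions about the sum reduce to P by
moving Q across. -/
theorem mem_graph_addBounded {x y : H} :
    (x, y) ∈ (addBounded P Q).graph ↔ (x, y - Q x) ∈ P.graph := by
  constructor
  · intro h
    obtain ⟨z, hz, hy⟩ := (LinearPMap.mem_graph_iff _).1 h
    have hzP : (z : H) ∈ P.domain := z.2.1
    refine (LinearPMap.mem_graph_iff _).2 ⟨⟨z, hzP⟩, hz, ?_⟩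
    have h1 : (addBounded P Q) z = P ⟨z, hzP⟩ + Q z := rfl
    simp only at hz hy ⊢
    rw [← hy, ← hz, h1, add_sub_cancel_right]
  · intro h
    obtain ⟨z, hz, hy⟩ := (LinearPMap.mem_graph_iff _).1 h
    have hzQ : (z : H) ∈ (addBounded P Q).domain := ⟨z.2, trivial⟩
    refine (LinearPMap.mem_graph_iff _).2 ⟨⟨z, hzQ⟩, hz, ?_⟩
    have h1 : (addBounded P Q) ⟨z, hzQ⟩ = P z + Q z := rfl
    simp only at hz hy ⊢
    rw [h1, hy, hz, sub_add_cancel]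

variable [CompleteSpace H]

/-- A bounded self-adjoint perturbation of a self-adjoint operator is self-adjoint. -/
theorem IsSelfAdjoint.isSelfAdjoint_addBounded (hP : IsSelfAdjoint P) (hQ : IsSelfAdjoint Q) :
    IsSelfAdjoint (addBounded P Q) := by
  have hdom : (addBounded P Q).domain = P.domain := inf_top_eq P.domain
  have hQs : ∀ a x, ⟪Q a, x⟫_ℂ = ⟪a, Q x⟫_ℂ := fun a x => by
    conv_lhs => rw [← hQ.star_eq]
    rw [ContinuousLinearMap.star_eq_adjoint, ContinuousLinearMap.adjoint_inner_left]
  refine LinearPMap.isSelfAdjoint_of_mem_graph_iff (by rw [hdom]; exact hP.dense_domain)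
    fun x y => ?_
  rw [mem_graph_addBounded, LinearPMap.mem_graph_iff_of_isSelfAdjoint hP]
  constructor
  · intro h a b hab
    have h1 := h a _ (mem_graph_addBounded.1 hab)
    rw [inner_sub_left, inner_sub_right, hQs] at h1
    exact sub_left_injective h1
  · intro h a b hab
    have h1 := h a (b + Q a) (mem_graph_addBounded.2 (by rwa [add_sub_cancel_right]))
    rw [inner_add_left, hQs] at h1
    rw [inner_sub_right]
    exact eq_sub_of_add_eq h1

namespace IsUnitaryGroupOf

variable {A : H →ₗ.[ℂ] H} {U V : ℝ → H →L[ℂ] H}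

theorem norm_apply (hU : IsUnitaryGroupOf A U) (t : ℝ) (x : H) : ‖U t x‖ = ‖x‖ :=
  ContinuousLinearMap.norm_map_of_mem_unitary (hU.unitary_apply t) x

theorem continuous_apply_apply (hU : IsUnitaryGroupOf A U) {τ : ℝ → ℝ} (hτ : Continuous τ)
    {g : ℝ → H} (hg : Continuous g) : Continuous fun t => U (τ t) (g t) := by
  refine continuous_iff_continuousAt.2 fun t => ?_
  exact tendsto_apply_of_bounded (F := fun r => U (τ r)) (G := U (τ t)) (C := 1)
    (fun r v => by rw [one_mul, hU.norm_apply])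
    (((hU.continuous_apply (g t)).comp hτ).tendsto t) (hg.tendsto t)

theorem neg_mul_cancel (hU : IsUnitaryGroupOf A U) (t : ℝ) : U (-t) * U t = 1 := by
  rw [← hU.map_add, neg_add_cancel, hU.map_zero]

/-- The strong derivative of `e^{it(P+Q)} e^{-itP}`. -/
theorem hasDerivAt_mul_neg (hP : Dense (P.domain : Set H)) (hU : IsUnitaryGroupOf P U)
    (hV : IsUnitaryGroupOf (addBounded P Q) V) (x : H) (t : ℝ) :
    HasDerivAt (fun t => (V t * U (-t)) x) (Complex.I • V t (Q (U (-t) x))) t := by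
  have hcont : ∀ x, Continuous fun s => Complex.I • V s (Q (U (-s) x)) := fun x =>
    (hV.continuous_apply_apply continuous_id
      (Q.continuous.comp (hU.continuous_apply_apply continuous_neg continuous_const))).const_smul _
  -- On the domain of P the product rule applies: the two P terms cancel and only Q survives.
  have hdom : ∀ x y, (x, y) ∈ P.graph → ∀ t,
      HasDerivAt (fun t => (V t * U (-t)) x) (Complex.I • V t (Q (U (-t) x))) t := by
    intro x y hxy t
    have h1 : HasDerivAt (fun t => U (-t) x) (-(Complex.I • U (-t) y)) t := by
      have := (hU.hasDerivAt hxy (-t)).scomp t (hasDerivAt_neg t)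
      rw [neg_one_smul] at this
      exact this
    have h2 : (U (-t) x, U (-t) y + Q (U (-t) x)) ∈ (addBounded P Q).graph := by
      rw [mem_graph_addBounded, add_sub_cancel_right]
      exact hU.apply_mem_graph hxy (-t)
    have h3 := hV.hasDerivAt h2 t
    have h4 := HasDerivWithinAt.apply_of_bounded (F := V) (C := 1) (s := Set.univ)
      (fun r v => by rw [one_mul, hV.norm_apply]) h3.hasDerivWithinAt
      (hV.continuous_apply _).continuousWithinAt h1.hasDerivWithinAt
    rw [hasDerivWithinAt_univ] at h4
    refine HasDerivAt.congr_deriv (f := fun t => (V t * U (-t)) x) h4 ?_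
    simp only [_root_.map_add, map_neg, map_smul]
    module
  have hbdd : ∀ s v, ‖(Complex.I • V s * Q * U (-s)) v‖ ≤ ‖Q‖ * ‖v‖ := fun s v => by
    have h1 : (Complex.I • V s * Q * U (-s)) v = Complex.I • V s (Q (U (-s) v)) := rfl
    rw [h1, norm_smul, Complex.norm_I, one_mul, hV.norm_apply]
    exact (Q.le_opNorm _).trans_eq (by rw [hU.norm_apply])
  -- Both sides are bounded operators applied to x, so the integrated equation extends from the
  -- dense domain to every vector; its integrand is continuous, so it can be differentiated again.
  have hint : ∀ x t, (V t * U (-t)) x =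
      x + ∫ s in (0 : ℝ)..t, Complex.I • V s (Q (U (-s) x)) := by
    intro x t
    obtain ⟨T, hT⟩ := exists_hasStrongIntegral (F := fun s => Complex.I • V s * Q * U (-s))
      hbdd hcont 0 t
    have h1 : (V t * U (-t)) x = (1 + T) x := by
      refine congrFun (Continuous.ext_on hP (V t * U (-t)).continuous (1 + T).continuous ?_) x
      intro z hz
      obtain ⟨y, hzy⟩ := LinearPMap.mem_domain_iff.1 hz
      have h2 := intervalIntegral.integral_eq_sub_of_hasDerivAt (a := 0) (b := t)
        (fun s _ => hdom z y hzy s) ((hcont z).intervalIntegrable _ _)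
      have h3 : T z = (V t * U (-t)) z - (V 0 * U (-0)) z := (hT z).2.trans h2
      have h4 : (1 + T) z = z + T z := rfl
      rw [h4, h3, neg_zero, hV.map_zero, hU.map_zero]
      simp
    rw [h1]
    exact congrArg (x + ·) (hT x).2
  have h := (hasDerivAt_integral_of_continuous (hcont x) 0 t).const_add x
  exact h.congr_of_eventuallyEq (Eventually.of_forall fun t => hint x t)

end IsUnitaryGroupOf

end Perturbation

/-! ### The conjugates e^{itP} Q e^{-itP} and their strong integral. -/

section Conjugates

variable {H : Type*} [NormedAddCommGroup H] [InnerProductSpace ℂ H] [CompleteSpace H]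
  {P : H →ₗ.[ℂ] H} {Q : H →L[ℂ] H}

theorem IsSelfAdjoint.norm_conjExpI_apply_le (hP : IsSelfAdjoint P) (t : ℝ) (x : H) :
    ‖conjExpI P Q t x‖ ≤ ‖Q‖ * ‖x‖ := by
  have hU := hP.isUnitaryGroupOf_expI
  have h1 : conjExpI P Q t x = expI P t (Q (expI P (-t) x)) := rfl
  rw [h1, hU.norm_apply]
  exact (Q.le_opNorm _).trans_eq (by rw [hU.norm_apply])

theorem IsSelfAdjoint.continuous_conjExpI_apply (hP : IsSelfAdjoint P) (x : H) :
    Continuous fun t => conjExpI P Q t x :=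
  have hU := hP.isUnitaryGroupOf_expI
  hU.continuous_apply_apply continuous_id
    (Q.continuous.comp (hU.continuous_apply_apply continuous_neg continuous_const))

theorem IsSelfAdjoint.hasStrongIntegral_conjExpI (hP : IsSelfAdjoint P) (a b : ℝ) :
    HasStrongIntegral (conjExpI P Q) a b (strongIntegral (conjExpI P Q) a b) := by
  obtain ⟨T, hT⟩ := exists_hasStrongIntegral (F := conjExpI P Q) hP.norm_conjExpI_apply_le
    hP.continuous_conjExpI_apply a b
  rwa [hT.strongIntegral_eq]

/-- The uniform bound ‖Q‖ on the conjugates makes the strong integral Lipschitz in operator norm, as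
`HasDerivWithinAt.exp_apply` requires. -/
theorem IsSelfAdjoint.norm_strongIntegral_conjExpI_sub_le (hP : IsSelfAdjoint P) (s t : ℝ) :
    ‖strongIntegral (conjExpI P Q) 0 s - strongIntegral (conjExpI P Q) 0 t‖ ≤ ‖Q‖ * ‖s - t‖ := by
  refine ContinuousLinearMap.opNorm_le_bound _ (by positivity) fun x => ?_
  have hi := fun a b => (hP.hasStrongIntegral_conjExpI (Q := Q) a b x).1
  rw [sub_apply, (hP.hasStrongIntegral_conjExpI 0 s x).2,
    (hP.hasStrongIntegral_conjExpI 0 t x).2,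
    intervalIntegral.integral_interval_sub_left (hi 0 s) (hi 0 t)]
  refine (intervalIntegral.norm_integral_le_of_norm_le_const
    fun r _ => hP.norm_conjExpI_apply_le r x).trans_eq ?_
  rw [Real.norm_eq_abs]
  ring

end Conjugates

/-! ### The exponential identity. -/

theorem mainTheorem6 {H : Type*} [NormedAddCommGroup H] [InnerProductSpace ℂ H] [CompleteSpace H]
    [TopologicalSpace.SeparableSpace H] (P : H →ₗ.[ℂ] H) (hP : IsSelfAdjoint P)
    (Q : H →L[ℂ] H) (hQ : IsSelfAdjoint Q)
    (hcomm : ∀ t ∈ Set.Icc (0 : ℝ) 1, ∀ s ∈ Set.Icc (0 : ℝ) 1,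
      Commute (conjExpI P Q t) (conjExpI P Q s)) :
    -- all objects in the identity are well defined
    IsSelfAdjoint (addBounded P Q) ∧
    IsUnitaryGroupOf P (expI P) ∧
    IsUnitaryGroupOf (addBounded P Q) (expI (addBounded P Q)) ∧
    HasStrongIntegral (conjExpI P Q) 0 1 (strongIntegral (conjExpI P Q) 0 1) ∧
    -- the identity itself
    NormedSpace.exp (Complex.I • strongIntegral (conjExpI P Q) 0 1) * expI P 1 =
      expI (addBounded P Q) 1 := by
  let _ : NormedAlgebra ℚ (H →L[ℂ] H) := NormedAlgebra.restrictScalars ℚ ℂ _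
  have hPQ := hP.isSelfAdjoint_addBounded hQ
  have hU := hP.isUnitaryGroupOf_expI
  have hV := hPQ.isUnitaryGroupOf_expI
  refine ⟨hPQ, hU, hV, hP.hasStrongIntegral_conjExpI 0 1, ?_⟩
  set U := expI P
  set V := expI (addBounded P Q)
  set K := conjExpI P Q with hK
  let S : ℝ → H →L[ℂ] H := fun t => strongIntegral K 0 t
  have hS : ∀ t, HasStrongIntegral K 0 t (S t) := hP.hasStrongIntegral_conjExpI 0
  have hsub : ∀ t ∈ Set.Icc (0 : ℝ) 1, Set.uIcc 0 t ⊆ Set.Icc 0 1 := fun t ht => by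
    rw [Set.uIcc_of_le ht.1]; exact Set.Icc_subset_Icc_right ht.2
  have hKS : ∀ s ∈ Set.Icc (0 : ℝ) 1, ∀ t ∈ Set.Icc (0 : ℝ) 1, Commute (K s) (S t) :=
    fun s hs t ht => (hS t).commute fun r hr => hcomm s hs r (hsub t ht hr)
  have hSS : ∀ s ∈ Set.Icc (0 : ℝ) 1, ∀ t ∈ Set.Icc (0 : ℝ) 1, Commute (S s) (S t) :=
    fun s hs t ht => (hS t).commute fun r hr => (hKS r (hsub t ht hr) s hs).symm
  have hS0 : S 0 = 0 := ContinuousLinearMap.ext fun x => by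
    rw [(hS 0 x).2]; simp
  have hSd : ∀ x t, HasDerivAt (fun r => S r x) (K t x) t := fun x t => by
    have := hasDerivAt_integral_of_continuous (hP.continuous_conjExpI_apply (Q := Q) x) 0 t
    exact this.congr_of_eventuallyEq (Eventually.of_forall fun r => (hS r x).2)
  let E : ℝ → H →L[ℂ] H := fun t => NormedSpace.exp (-Complex.I • S t)
  -- Derivatives are taken within [0,1], since commutation is known only there.
  have hE : ∀ x, ∀ t ∈ Set.Icc (0 : ℝ) 1,
      HasDerivWithinAt (fun r => E r x) (E t (-Complex.I • K t x)) (Set.Icc 0 1) t := by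
    intro x t ht
    refine HasDerivWithinAt.exp_apply (S := fun r => -Complex.I • S r) ht
      (fun r hr => ((hSS t ht r hr).smul_right _).smul_left _) ?_
      ((hSd x t).const_smul (-Complex.I)).hasDerivWithinAt
    refine Asymptotics.IsBigO.of_bound ‖Q‖ (Eventually.of_forall fun r => ?_)
    rw [← smul_sub, norm_smul, norm_neg, Complex.norm_I, one_mul]
    exact hP.norm_strongIntegral_conjExpI_sub_le r t
  have hderiv : ∀ x, ∀ t ∈ Set.Icc (0 : ℝ) 1,
      HasDerivWithinAt (fun r => (V r * U (-r)) (E r x)) 0 (Set.Icc 0 1) t := by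
    intro x t ht
    have h1 := HasDerivWithinAt.apply_of_bounded (F := fun r => V r * U (-r)) (C := 1)
      (fun r v => by rw [one_mul, mul_apply_eq_comp, hV.norm_apply, hU.norm_apply])
      (hU.hasDerivAt_mul_neg hP.dense_domain hV (E t x) t).hasDerivWithinAt
      (hU.hasDerivAt_mul_neg hP.dense_domain hV _ t).continuousAt.continuousWithinAt (hE x t ht)
    refine h1.congr_deriv ?_
    -- Moving K(t) to the left of E(t) lets the derivatives i V(t) U(-t) K(t) E(t) x and -i V(t)
    -- U(-t) K(t) E(t) x of the two factors cancel.
    have h2 : Commute (K t) (E t) := ((hKS t ht t ht).smul_right _).exp_right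
    have h3 : E t (-Complex.I • K t x) = -Complex.I • K t (E t x) := by
      rw [map_smul, ← mul_apply_eq_comp (E t), ← h2.eq, mul_apply_eq_comp]
    have h4 : (V t * U (-t)) (K t (E t x)) = V t (Q (U (-t) (E t x))) := by
      have : V t * U (-t) * (U t * Q * U (-t)) = V t * Q * U (-t) := by
        rw [mul_assoc (U t), mul_assoc (V t), ← mul_assoc (U (-t)), hU.neg_mul_cancel, one_mul,
          mul_assoc]
      exact DFunLike.congr_fun this (E t x)
    rw [h3, map_smul, h4]
    module
  have hconst : V 1 * U (-1) * E 1 = 1 := by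
    refine ContinuousLinearMap.ext fun x => ?_
    have h := Convex.norm_image_sub_le_of_norm_hasDerivWithin_le (C := 0) (hderiv x)
      (fun t _ => by simp) (convex_Icc 0 1) (Set.left_mem_Icc.2 zero_le_one)
      (Set.right_mem_Icc.2 zero_le_one)
    rw [zero_mul, norm_le_zero_iff, sub_eq_zero] at h
    refine h.trans ?_
    simp [E, hS0, hV.map_zero, hU.map_zero]
  have hEinv : E 1 * NormedSpace.exp (Complex.I • S 1) = 1 := by
    rw [← NormedSpace.exp_add_of_commute (((Commute.refl (S 1)).smul_right _).smul_left _),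
      neg_smul, neg_add_cancel, NormedSpace.exp_zero]
  calc NormedSpace.exp (Complex.I • S 1) * U 1
      = V 1 * U (-1) * E 1 * NormedSpace.exp (Complex.I • S 1) * U 1 := by rw [hconst, one_mul]
    _ = V 1 * U (-1) * U 1 := by rw [mul_assoc (V 1 * U (-1)), hEinv, mul_one]
    _ = V 1 := by rw [mul_assoc, hU.neg_mul_cancel, mul_one]
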